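/- A represented space is a set $X$ with a partial surjection $\delta_X :\subseteq \mathbb{N}^{\mathbb{N}} \to X$; the elements of $\delta_X^{-1}(x)$ are the names of $x$. A map between represented spaces is computable if a computable partial function on $\mathbb{N}^{\mathbb{N}}$ turns every name of a point into a name of its image; a sequence of points is computable if names of its terms can be computed uniformly. $U \subseteq X$ is open if $\delta_X^{-1}(U)$ is relatively open in $\operatorname{dom}(\delta_X)$. A name of $U$ in the space $\mathcal{O}(X)$ of open sets lists finite words such that a $p \in \operatorname{dom}(\delta_X)$ lies in $\delta_X^{-1}(U)$ iff $p$ has one of the listed words as a prefix. $\mathcal{K}(X)$ is the space of (saturated) compact sets, where a name of $B$ is a name of $\{U \in \mathcal{O}(X) \mid B \subseteq U\} \in \mathcal{O}(\mathcal{O}(X))$. $(\mathcal{A}\wedge\mathcal{V})(X)$ is the space of closed subsets $A \subseteq X$, where a name of $A$ is a pair of a name of $X \setminus A \in \mathcal{O}(X)$ and a name of $\{U \in \mathcal{O}(X) \mid A \cap U \neq \emptyset\} \in \mathcal{O}(\mathcal{O}(X))$. Sierpiński space is $\mathbb{S} = \{\bot,\top\}$, where $0^\omega$ is the only name of $\bot$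 and all other sequences are names of $\top$. A represented space $Y$ is computably compact if the map $\mathcal{O}(Y) \to \mathbb{S}$ that takes the value $\top$ exactly at $U = Y$ is computable. An effective relatively compact system (ercs) of $X$ is a triple $((U_n)_{n\in\mathbb{N}}, (B_n)_{n\in\mathbb{N}}, R)$ where $(U_n)$ is a computable sequence in $\mathcal{O}(X)$, $(B_n)$ is a computable sequence in $\mathcal{K}(X)$, and $R \subseteq \mathbb{N}\times\mathbb{N}$ is computably enumerable such that $(m,n) \in R$ implies $U_m \subseteq B_n$, and such that for every open $U \subseteq X$ $$U = \bigcup_{\{n \mid U \supseteq B_n\}} \; \bigcup_{\{m \mid (m,n)\in R\}} U_m .$$ Corollary. If a represented space $X$ admits an ercs, then $(\mathcal{A}\wedge\mathcal{V})(X)$ is computably compact. -/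

import Mathlib

universe u v

namespace RepresentedSpace

/-- A represented space with underlying set `X`: a partial surjection from Baire space `ℕ → ℕ`
onto `X`, given by its graph (`Names p x` says that `p` is a name of `x`). -/
structure Representation (X : Type u) where
  Names : (ℕ → ℕ) → X → Prop
  unique : ∀ p x y, Names p x → Names p y → x = y
  surj : ∀ x, ∃ p, Names p x

/-- The finite word `p 0, …, p (k - 1)`. -/
def pre (p : ℕ → ℕ) (k : ℕ) : List ℕ := (List.range k).map p

/-- A map between represented spaces is computable if some computable partial function on Baire
space turns every name of `x` into a name of `f x`. A computable partial function on Baire space is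
the limit of a computable function on finite words that is monotone for the prefix order. -/
def ComputableMap {X : Type u} {Y : Type v} (δ : Representation X) (ε : Representation Y)
    (f : X → Y) : Prop :=
  ∃ h : List ℕ → List ℕ, Computable h ∧ (∀ w w', w <+: w' → h w <+: h w') ∧
    ∀ p x, δ.Names p x → ∃ q, ε.Names q (f x) ∧
      (∀ k, ∃ l, h (pre p k) = pre q l) ∧ (∀ l, ∃ k, l ≤ (h (pre p k)).length)

/-- A computable sequence of points: names of the points can be computed uniformly. -/
def ComputableSeq {X : Type u} (δ : Representation X) (x : ℕ → X) : Prop :=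
  ∃ f : ℕ → ℕ → ℕ, Computable₂ f ∧ ∀ n, δ.Names (f n) (x n)

/-- Sierpiński space: the constant sequence `0` is the only name of `False` (bottom), all other
sequences are names of `True` (top). -/
def sierpinski : Representation Prop where
  Names p b := b ↔ ∃ n, p n ≠ 0
  unique _ _ _ h h' := propext (h.trans h'.symm)
  surj b := by
    by_cases hb : b
    · exact ⟨fun _ => 1, by simp [hb]⟩
    · exact ⟨fun _ => 0, by simp [hb]⟩

/-- `p` is a name of the open set `U`: it lists (codes of) finite words such that a name `q` of a
point belongs to the preimage of `U` iff `q` has one of the listed words as a prefix.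
The entry `0` lists nothing. -/
def OpenName {X : Type u} (δ : Representation X) (p : ℕ → ℕ) (U : Set X) : Prop :=
  ∀ q x, δ.Names q x → (x ∈ U ↔ ∃ n k, p n = Encodable.encode (pre q k) + 1)

/-- The open subsets of a represented space: the preimage is relatively open in the set of all
names. -/
def RepOpen {X : Type u} (δ : Representation X) (U : Set X) : Prop :=
  ∃ p, OpenName δ p U

theorem OpenName.unique {X : Type u} {δ : Representation X} {p : ℕ → ℕ} {U V : Set X}
    (hU : OpenName δ p U) (hV : OpenName δ p V) : U = V := by
  ext x
  obtain ⟨q, hq⟩ := δ.surj x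
  exact (hU q x hq).trans (hV q x hq).symm

/-- Any set of words can be listed. -/
theorem exists_listing (W : Set (List ℕ)) :
    ∃ p : ℕ → ℕ, ∀ w, (∃ n, p n = Encodable.encode w + 1) ↔ w ∈ W := by
  classical
  refine ⟨fun n => if ∃ w ∈ W, Encodable.encode w = n then n + 1 else 0, fun w => ⟨?_, ?_⟩⟩
  · rintro ⟨n, hn⟩
    dsimp only at hn
    split_ifs at hn with h
    obtain ⟨w', hw', rfl⟩ := h
    exact Encodable.encode_injective (Nat.succ_injective hn) ▸ hw'
  · intro hw
    exact ⟨Encodable.encode w, if_pos ⟨w, hw, rfl⟩⟩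

/-- The set of open subsets. -/
abbrev OpenSet {X : Type u} (δ : Representation X) : Type u := {U : Set X // RepOpen δ U}

/-- The hyperspace `𝒪(X)` of open subsets. -/
def openRep {X : Type u} (δ : Representation X) : Representation (OpenSet δ) where
  Names p U := OpenName δ p U.1
  unique _ _ _ h h' := Subtype.ext (h.unique h')
  surj U := U.2

/-- The open sets that contain `B`. -/
def containing {X : Type u} (δ : Representation X) (B : Set X) : Set (OpenSet δ) :=
  {U | B ⊆ U.1}

/-- The open sets that meet `A`. -/
def hitting {X : Type u} (δ : Representation X) (A : Set X) : Set (OpenSet δ) :=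
  {U | (A ∩ U.1).Nonempty}

/-- The set of compact subsets: the saturated `B` (intersections of open sets) such that
`{U | B ⊆ U}` is open in `𝒪(X)`. -/
abbrev CompactSet {X : Type u} (δ : Representation X) : Type u :=
  {B : Set X // (∀ x, (∀ U, RepOpen δ U → B ⊆ U → x ∈ U) → x ∈ B) ∧
    RepOpen (openRep δ) (containing δ B)}

/-- The hyperspace `𝒦(X)` of compact subsets: a name of `B` is a name of
`{U ∈ 𝒪(X) | B ⊆ U} ∈ 𝒪(𝒪(X))`. -/
def compactRep {X : Type u} (δ : Representation X) : Representation (CompactSet δ) where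
  Names p B := OpenName (openRep δ) p (containing δ B.1)
  unique p B C hB hC := by
    have h : containing δ B.1 = containing δ C.1 := hB.unique hC
    refine Subtype.ext (Set.Subset.antisymm (fun x hx => C.2.1 x ?_) (fun x hx => B.2.1 x ?_))
    · intro U hU hCU
      have : (⟨U, hU⟩ : OpenSet δ) ∈ containing δ B.1 := h ▸ hCU
      exact this hx
    · intro U hU hBU
      have : (⟨U, hU⟩ : OpenSet δ) ∈ containing δ C.1 := h ▸ hBU
      exact this hx
  surj B := B.2.2

/-- `p` is a name of `A` as an overt set: a name of `{U ∈ 𝒪(X) | A ∩ U ≠ ∅} ∈ 𝒪(𝒪(X))`. -/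
def OvertName {X : Type u} (δ : Representation X) (p : ℕ → ℕ) (A : Set X) : Prop :=
  OpenName (openRep δ) p (hitting δ A)

theorem exists_overtName {X : Type u} (δ : Representation X) (A : Set X) :
    ∃ p, OvertName δ p A := by
  obtain ⟨p, hp⟩ := exists_listing {w | ∃ x ∈ A, ∃ q k, δ.Names q x ∧
    Encodable.encode (pre q k) + 1 ∈ w}
  refine ⟨p, fun r U hr => ?_⟩
  rw [exists_comm]
  simp only [hp]
  constructor
  · rintro ⟨x, hxA, hxU⟩
    obtain ⟨q, hq⟩ := δ.surj x
    obtain ⟨n, k, hnk⟩ := (hr q x hq).1 hxU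
    exact ⟨n + 1, x, hxA, q, k, hq, List.mem_map.2 ⟨n, by simp, hnk⟩⟩
  · rintro ⟨m, x, hxA, q, k, hq, hm⟩
    obtain ⟨n, -, hn⟩ := List.mem_map.1 hm
    exact ⟨x, hxA, (hr q x hq).2 ⟨n, k, hn⟩⟩

/-- The set of closed subsets. -/
abbrev ClosedSet {X : Type u} (δ : Representation X) : Type u := {A : Set X // RepOpen δ Aᶜ}

/-- The hyperspace `(𝒜 ∧ 𝒱)(X)` of closed-and-overt subsets: a name of `A` is a pair (interleaved)
of a name of the open set `Aᶜ` and a name of `A` as an overt set. -/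
def closedOvertRep {X : Type u} (δ : Representation X) : Representation (ClosedSet δ) where
  Names p A := OpenName δ (fun n => p (2 * n)) A.1ᶜ ∧ OvertName δ (fun n => p (2 * n + 1)) A.1
  unique _ _ _ h h' := Subtype.ext (compl_injective (h.1.unique h'.1))
  surj A := by
    obtain ⟨a, ha⟩ := A.2
    obtain ⟨b, hb⟩ := exists_overtName δ A.1
    refine ⟨fun n => if n % 2 = 0 then a (n / 2) else b (n / 2), ?_, ?_⟩
    · convert ha using 2 with n
      simp
    · convert hb using 2 with n
      have h1 : (2 * n + 1) % 2 ≠ 0 := by omega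
      have h2 : (2 * n + 1) / 2 = n := by omega
      simp [h2]

/-- Computable compactness: the map `𝒪(X) → 𝕊` that recognizes `U = X` is computable. -/
def ComputablyCompact {X : Type u} (δ : Representation X) : Prop :=
  ComputableMap (openRep δ) sierpinski (fun U => U.1 = Set.univ)

/-- An effective relatively compact system: a computable sequence `U` of open sets, a computable
sequence `B` of compact sets and a computably enumerable relation `R` such that `R m n` implies
`U m ⊆ B n`, and every open set `V` is the union of the `U m` with `R m n` for some `B n ⊆ V`. -/
structure Ercs {X : Type u} (δ : Representation X) where
  U : ℕ → OpenSet δ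
  B : ℕ → CompactSet δ
  R : ℕ → ℕ → Prop
  computable_U : ComputableSeq (openRep δ) U
  computable_B : ComputableSeq (compactRep δ) B
  re_R : REPred fun mn : ℕ × ℕ => R mn.1 mn.2
  subset_of_R : ∀ m n, R m n → (U m).1 ⊆ (B n).1
  eq_iUnion : ∀ V : Set X, RepOpen δ V →
    V = ⋃ (n : ℕ) (_ : (B n).1 ⊆ V) (m : ℕ) (_ : R m n), (U m).1

end RepresentedSpace

namespace RepresentedSpace

/-! Names of all closed sets can be built from binary decisions, which lets Cantor space supply the
compactness. From the ercs take open sets `U i` and upward closed open families `F i` of supersets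
of `U i`. A bit sequence `b` puts `U i` into the complement if `b i = false` and `F i` into the
overt part if `b i = true`. Letting `b i` say whether `U i` meets `A` gives a name of `A`
(`exists_consistent`, `Consistent.names`). Conversely, `b` names some closed set unless its overt
part accepts its own complement, an overlap that a finite prefix reveals
(`exists_consistent_of_not_overlap`).

So an open set of closed sets is everything iff each `b` is caught, by a listed word or by an
overlap (`eq_univ_iff_forall_caught`). Compactness of Cantor space yields one finite stage that
catches all `b` (`forall_caught_iff`), and each stage is decidable (`primrecRel_allCaught`). -/

/-! ### Finite prefixes and stages of enumeration -/

theorem length_pre (p : ℕ → ℕ) (k : ℕ) : (pre p k).length = k := by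
  simp [pre]

theorem take_pre (p : ℕ → ℕ) {l k : ℕ} (h : l ≤ k) : (pre p k).take l = pre p l := by
  simp [pre, ← List.map_take, List.take_range, Nat.min_eq_left h]

theorem getD_pre (p : ℕ → ℕ) (k n : ℕ) : (pre p k).getD n 0 = if n < k then p n else 0 := by
  by_cases h : n < k <;> simp [pre, h]

theorem pre_congr {p q : ℕ → ℕ} {k : ℕ} (h : ∀ n < k, p n = q n) : pre p k = pre q k := by
  simpa [pre] using h

theorem mem_pre {p : ℕ → ℕ} {k a : ℕ} : a ∈ pre p k ↔ ∃ n < k, p n = a := by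
  simp [pre]

/-- Finite prefixes of a computable sequence can be computed from their length. -/
theorem computable_pre {g : ℕ → ℕ} (hg : Computable g) : Computable (pre g) := by
  have h : Computable fun k : ℕ =>
      (Nat.rec [] (fun n l => l ++ [g n]) k : List ℕ) :=
    Computable.nat_rec (h := fun _ (x : ℕ × List ℕ) => x.2 ++ [g x.1]) Computable.id
      (Computable.const [])
      (Computable.list_concat.comp (Computable.snd.comp Computable.snd)
        (hg.comp (Computable.fst.comp Computable.snd))).to₂
  refine h.of_eq fun k => ?_
  induction k with
  | zero => rfl
  | succ k ih => simp only [ih]; simp [pre, List.range_succ]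

/-- A recursively enumerable predicate is the projection of a decidable relation. -/
theorem exists_stages {α : Type*} [Primcodable α] {P : α → Prop} (hP : REPred P) :
    ∃ D : α → ℕ → Bool, Computable₂ D ∧ ∀ a, P a ↔ ∃ t, D a t = true := by
  obtain ⟨c, hc⟩ := Nat.Partrec.Code.exists_code.1 (Partrec.bind_decode₂_iff.1 hP)
  refine ⟨fun a t => (Nat.Partrec.Code.evaln t c (Encodable.encode a)).isSome, ?_, fun a => ?_⟩
  · exact (Primrec.option_isSome.comp (Nat.Partrec.Code.primrec_evaln.comp
      ((Primrec.snd.pair (Primrec.const c)).pair (Primrec.encode.comp Primrec.fst)))).to_comp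
  · have h : P a ↔ (c.eval (Encodable.encode a)).Dom := by
      rw [hc]
      simp [Part.assert]
    rw [h, Part.dom_iff_mem]
    simp only [Nat.Partrec.Code.evaln_complete, Option.isSome_iff_exists, Option.mem_def]
    exact exists_comm

/-! ### Choices, finite approximations and compactness -/

/-- The index of the basic set to which position `n` of a name of a closed set is devoted. -/
def blockIndex (n : ℕ) : ℕ := (n / 2).unpair.1

/-- The candidate name of a closed set obtained from the master sequence `g` by retaining, for each
index `i`, the even entries if `b i = false` and the odd entries if `b i = true`. -/
def select (g : ℕ → ℕ) (b : ℕ → Bool) (n : ℕ) : ℕ :=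
  if b (blockIndex n) = decide (n % 2 = 1) then g n else 0

/-- Some word listed by `p` is a prefix of `s`, or some word listed in the odd part of `s` is a
prefix of the even part of `s`. -/
def Caught (p s : ℕ → ℕ) : Prop :=
  ∃ l, (∃ n, p n = Encodable.encode (pre s l) + 1) ∨
    ∃ n, s (2 * n + 1) = Encodable.encode (pre (fun j => s (2 * j)) l) + 1

/-- The finite approximation of `Caught`. -/
def CaughtWord (w v : List ℕ) : Prop :=
  ∃ l < v.length, Encodable.encode (v.take l) + 1 ∈ w ∨
    -- The bound keeps the default 0 out of the even word, where it could pass for an entry. In the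
    -- odd list it is harmless, since listed codes are successors.
    (2 * l ≤ v.length ∧ Encodable.encode ((List.range l).map fun j => v.getD (2 * j) 0) + 1 ∈
      (List.range v.length).map fun n => v.getD (2 * n + 1) 0)

theorem caughtWord_pre_iff (p s : ℕ → ℕ) (k : ℕ) : CaughtWord (pre p k) (pre s k) ↔
    ∃ l < k, (∃ n < k, p n = Encodable.encode (pre s l) + 1) ∨
      (2 * l ≤ k ∧ ∃ n, 2 * n + 1 < k ∧
        s (2 * n + 1) = Encodable.encode (pre (fun j => s (2 * j)) l) + 1) := by
  unfold CaughtWord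
  rw [length_pre]
  refine exists_congr fun l => and_congr_right fun hl => ?_
  rw [take_pre s hl.le, mem_pre]
  refine or_congr_right (and_congr_right fun h2 => ?_)
  have h : ((List.range l).map fun j => (pre s k).getD (2 * j) 0) = pre (fun j => s (2 * j)) l := by
    refine List.map_congr_left fun j hj => ?_
    rw [getD_pre, if_pos]
    have := List.mem_range.1 hj
    omega
  rw [h]
  simp only [List.mem_map, List.mem_range, getD_pre]
  constructor
  · rintro ⟨n, -, hn⟩
    split_ifs at hn with hk
    exact ⟨n, hk, hn⟩
  · rintro ⟨n, hk, hn⟩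
    exact ⟨n, by omega, by rw [if_pos hk, hn]⟩

theorem CaughtWord.mono {p s : ℕ → ℕ} {k k' : ℕ} (hk : k ≤ k')
    (h : CaughtWord (pre p k) (pre s k)) : CaughtWord (pre p k') (pre s k') := by
  rw [caughtWord_pre_iff] at h ⊢
  obtain ⟨l, hl, ⟨n, hn, h⟩ | ⟨h2, n, hn, h⟩⟩ := h
  · exact ⟨l, by omega, Or.inl ⟨n, by omega, h⟩⟩
  · exact ⟨l, by omega, Or.inr ⟨by omega, n, by omega, h⟩⟩

theorem caught_iff_exists_caughtWord (p s : ℕ → ℕ) :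
    Caught p s ↔ ∃ k, CaughtWord (pre p k) (pre s k) := by
  simp only [caughtWord_pre_iff]
  constructor
  · rintro ⟨l, ⟨n, h⟩ | ⟨n, h⟩⟩
    · exact ⟨l + n + 1, l, by omega, Or.inl ⟨n, by omega, h⟩⟩
    · exact ⟨2 * l + 2 * n + 2, l, by omega, Or.inr ⟨by omega, n, by omega, h⟩⟩
  · rintro ⟨k, l, -, ⟨n, -, h⟩ | ⟨-, n, -, h⟩⟩
    · exact ⟨l, Or.inl ⟨n, h⟩⟩
    · exact ⟨l, Or.inr ⟨n, h⟩⟩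

/-- The version of `select` on finite words, with the choice given by the binary digits of `c`. -/
def selectWord (t : List ℕ) (c : ℕ) : List ℕ :=
  (List.range t.length).map fun n =>
    if c.testBit (blockIndex n) = decide (n % 2 = 1) then t.getD n 0 else 0

/-- All choices on the finite word `t` are caught by `w`. -/
def AllCaught (w t : List ℕ) : Prop :=
  ∀ c < 2 ^ t.length, CaughtWord w (selectWord t c)

theorem blockIndex_le (n : ℕ) : blockIndex n ≤ n :=
  (Nat.unpair_left_le _).trans (Nat.div_le_self _ _)

theorem selectWord_pre (g : ℕ → ℕ) (k c : ℕ) :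
    selectWord (pre g k) c = pre (select g c.testBit) k := by
  unfold selectWord
  rw [length_pre]
  refine List.map_congr_left fun n hn => ?_
  rw [getD_pre, if_pos (List.mem_range.1 hn)]
  rfl

/-- Entry `n` consults only bit `blockIndex n ≤ n`. -/
theorem pre_select_congr (g : ℕ → ℕ) {b b' : ℕ → Bool} {k : ℕ} (h : ∀ i < k, b i = b' i) :
    pre (select g b) k = pre (select g b') k :=
  pre_congr fun n hn => by simp only [select, h _ ((blockIndex_le n).trans_lt hn)]

/-- Only the first `k` bits of `b` matter, and these are the binary digits of some `c < 2 ^ k`. -/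
theorem allCaught_pre_iff (p g : ℕ → ℕ) (k : ℕ) : AllCaught (pre p k) (pre g k) ↔
    ∀ b : ℕ → Bool, CaughtWord (pre p k) (pre (select g b) k) := by
  unfold AllCaught
  simp only [selectWord_pre, length_pre]
  refine ⟨fun h b => ?_, fun h c _ => h _⟩
  rw [pre_select_congr g (b' := (Nat.ofBits fun i : Fin k => b i).testBit)]
  · exact h _ (Nat.ofBits_lt_two_pow _)
  · intro i hi
    rw [Nat.testBit_ofBits_lt _ _ hi]

/-- By compactness of Cantor space, if all choices are caught then a finite stage suffices. -/
theorem forall_caught_iff (p g : ℕ → ℕ) : (∀ b : ℕ → Bool, Caught p (select g b)) ↔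
    ∃ k, AllCaught (pre p k) (pre g k) := by
  simp only [allCaught_pre_iff, caught_iff_exists_caughtWord]
  refine ⟨fun h => ?_, fun ⟨k, hk⟩ b => ⟨k, hk b⟩⟩
  let S : ℕ → Set (ℕ → Bool) := fun k => {b | CaughtWord (pre p k) (pre (select g b) k)}
  have hopen : ∀ k, IsOpen (S k) := by
    intro k
    rw [isOpen_iff_mem_nhds]
    intro b hb
    have hcyl : {b' : ℕ → Bool | ∀ i ∈ Finset.range k, b' i = b i} ∈ nhds b := by
      have : IsOpen ((Finset.range k : Set ℕ).pi fun i => ({b i} : Set Bool)) :=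
        isOpen_set_pi (Finset.finite_toSet _) fun _ _ => isOpen_discrete _
      refine Filter.mem_of_superset (this.mem_nhds (by simp)) fun b' hb' i hi => ?_
      exact hb' i hi
    refine Filter.mem_of_superset hcyl fun b' hb' => ?_
    change CaughtWord _ _
    rw [pre_select_congr g (b' := b) fun i hi => hb' i (Finset.mem_range.2 hi)]
    exact hb
  have hmono : Monotone S := fun k k' hk b hb => CaughtWord.mono hk hb
  -- The cover is increasing, so a single member of it already covers Cantor space.
  obtain ⟨k, hk⟩ := isCompact_univ.elim_directed_cover S hopen
    (fun b _ => Set.mem_iUnion.2 (h b)) hmono.directed_le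
  exact ⟨k, fun b => hk (Set.mem_univ b)⟩

/-! ### Decidability of each stage -/

section Primrec

open Primrec

theorem primrec_blockIndex : Primrec blockIndex :=
  fst.comp (unpair.comp (nat_div.comp Primrec.id (const 2)))

theorem primrec_two_pow : Primrec fun n : ℕ => 2 ^ n := by
  refine (nat_rec₁ 1 (f := fun _ a => a * 2) (nat_mul.comp snd (const 2))).of_eq fun n => ?_
  induction n with
  | zero => rfl
  | succ n ih => rw [pow_succ, ← ih]

theorem primrec_testBit : Primrec₂ Nat.testBit := by
  have h : PrimrecRel fun c i : ℕ => c / 2 ^ i % 2 = 1 :=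
    Primrec.eq.comp (nat_mod.comp (nat_div.comp fst (primrec_two_pow.comp snd)) (const 2))
      (const 1)
  exact (primrecRel_iff_primrec_decide.1 h).of_eq fun c i => by
    rw [Nat.testBit_eq_decide_div_mod_eq]

theorem primrec_selectWord : Primrec₂ selectWord := by
  have hn : Primrec fun x : (List ℕ × ℕ) × ℕ => x.2 := snd
  have hbit : Primrec fun x : (List ℕ × ℕ) × ℕ => x.1.2.testBit (blockIndex x.2) :=
    primrec_testBit.comp (snd.comp fst) (primrec_blockIndex.comp hn)
  have hodd : Primrec fun x : (List ℕ × ℕ) × ℕ => decide (x.2 % 2 = 1) :=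
    PrimrecPred.decide (Primrec.eq.comp (nat_mod.comp hn (const 2)) (const 1))
  exact list_map (list_range.comp (list_length.comp fst))
    (ite (Primrec.eq.comp hbit hodd) ((list_getD 0).comp (fst.comp fst) hn) (const 0))

theorem primrecRel_mem : PrimrecRel fun (a : ℕ) (l : List ℕ) => a ∈ l :=
  ((PrimrecRel.exists_mem_list (R := fun a b : ℕ => a = b) Primrec.eq).comp snd fst).of_eq
    fun x => by simp

theorem primrecRel_caughtWord : PrimrecRel CaughtWord := by
  have hl : Primrec fun x : ℕ × (List ℕ × List ℕ) => x.1 := fst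
  have hw : Primrec fun x : ℕ × (List ℕ × List ℕ) => x.2.1 := fst.comp snd
  have hv : Primrec fun x : ℕ × (List ℕ × List ℕ) => x.2.2 := snd.comp snd
  have heven : Primrec fun x : ℕ × (List ℕ × List ℕ) =>
      (List.range x.1).map fun j => x.2.2.getD (2 * j) 0 :=
    list_map (list_range.comp hl)
      ((list_getD 0).comp (hv.comp fst) (nat_double.comp snd))
  have hodd : Primrec fun x : ℕ × (List ℕ × List ℕ) =>
      (List.range x.2.2.length).map fun n => x.2.2.getD (2 * n + 1) 0 :=
    list_map (list_range.comp (list_length.comp hv))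
      ((list_getD 0).comp (hv.comp fst) (nat_double_succ.comp snd))
  have h : PrimrecRel fun (l : ℕ) (x : List ℕ × List ℕ) =>
      Encodable.encode (x.2.take l) + 1 ∈ x.1 ∨
      (2 * l ≤ x.2.length ∧ Encodable.encode ((List.range l).map fun j => x.2.getD (2 * j) 0) + 1 ∈
        (List.range x.2.length).map fun n => x.2.getD (2 * n + 1) 0) :=
    (primrecRel_mem.comp (succ.comp (Primrec.encode.comp (list_take.comp hl hv))) hw).or
      ((nat_le.comp (nat_double.comp hl) (list_length.comp hv)).and
        (primrecRel_mem.comp (succ.comp (Primrec.encode.comp heven)) hodd))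
  exact (h.exists_mem_list.comp (list_range.comp (list_length.comp snd)) Primrec.id).of_eq
    fun x => by simp [CaughtWord]

theorem primrecRel_allCaught : PrimrecRel AllCaught := by
  have h : PrimrecRel fun (c : ℕ) (x : List ℕ × List ℕ) => CaughtWord x.1 (selectWord x.2 c) :=
    primrecRel_caughtWord.comp (fst.comp snd) (primrec_selectWord.comp (snd.comp snd) fst)
  exact (h.forall_mem_list.comp (list_range.comp (primrec_two_pow.comp (list_length.comp snd)))
    Primrec.id).of_eq fun x => by simp [AllCaught]

end Primrec

/-! ### The realizer into Sierpiński space -/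

open Classical in
/-- The word of truth values of `AllCaught` along the prefixes of `w` and `t`. -/
noncomputable def caughtBits (w t : List ℕ) : List ℕ :=
  (List.range w.length).map fun j => if AllCaught (w.take j) (t.take j) then 1 else 0

theorem primrec_caughtBits : Primrec₂ caughtBits := by
  classical
  have h : PrimrecPred fun x : (List ℕ × List ℕ) × ℕ =>
      AllCaught (x.1.1.take x.2) (x.1.2.take x.2) :=
    primrecRel_allCaught.comp (Primrec.list_take.comp Primrec.snd (Primrec.fst.comp Primrec.fst))
      (Primrec.list_take.comp Primrec.snd (Primrec.snd.comp Primrec.fst))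
  exact Primrec.list_map (Primrec.list_range.comp (Primrec.list_length.comp Primrec.fst))
    ((Primrec.ite h (Primrec.const 1) (Primrec.const 0)).of_eq fun _ => by congr)

/-- If `Caught` along all choices of a computable master sequence characterizes a property of
points, then this property is computably recognizable. -/
theorem computableMap_sierpinski_of_caught {X : Type*} {δ : Representation X} {f : X → Prop}
    {g : ℕ → ℕ} (hg : Computable g)
    (h : ∀ p x, δ.Names p x → (f x ↔ ∀ b : ℕ → Bool, Caught p (select g b))) :
    ComputableMap δ sierpinski f := by
  classical
  -- Output entry `j` depends only on the first `j` input entries, which gives monotonicity.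
  refine ⟨fun w => caughtBits w (pre g w.length), ?_, ?_, ?_⟩
  · exact primrec_caughtBits.to_comp.comp Computable.id
      ((computable_pre hg).comp Computable.list_length)
  · rintro w _ ⟨v, rfl⟩
    have hlen : w.length ≤ (w ++ v).length := by simp
    refine List.prefix_iff_eq_take.2 ?_
    simp only [caughtBits, List.length_map, List.length_range, ← List.map_take, List.take_range,
      Nat.min_eq_left hlen]
    refine List.map_congr_left fun j hj => ?_
    have hj := (List.mem_range.1 hj).le
    rw [take_pre g hj, take_pre g (hj.trans hlen), List.take_append_of_le_length hj]
  · intro p x hx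
    have hpre : ∀ k, caughtBits (pre p k) (pre g (pre p k).length) =
        pre (fun j => if AllCaught (pre p j) (pre g j) then 1 else 0) k := by
      intro k
      simp only [caughtBits, length_pre]
      refine List.map_congr_left fun j hj => ?_
      have hj := (List.mem_range.1 hj).le
      rw [take_pre g hj, take_pre p hj]
    refine ⟨fun j => if AllCaught (pre p j) (pre g j) then 1 else 0, ?_,
      fun k => ⟨k, hpre k⟩, fun l => ⟨l, ?_⟩⟩
    · change f x ↔ _
      rw [h p x hx, forall_caught_iff]
      simp
    · dsimp only
      rw [hpre, length_pre]

/-! ### Approximation systems and names of closed sets -/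

/-- A sequence of names of open sets `U i` and of upward closed open families `F i` of open sets
such that `F i` only contains supersets of `U i`, and every open `V` is the union of the
`U i` with `V ∈ F i`. -/
structure ApproxSystem {X : Type*} (δ : Representation X) (u β : ℕ → ℕ → ℕ) where
  U : ℕ → Set X
  F : ℕ → Set (OpenSet δ)
  name_U : ∀ i, OpenName δ (u i) (U i)
  name_F : ∀ i, OpenName (openRep δ) (β i) (F i)
  subset_of_mem : ∀ i V, V ∈ F i → U i ⊆ V.1
  upward : ∀ i (V W : OpenSet δ), V.1 ⊆ W.1 → V ∈ F i → W ∈ F i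
  exists_mem : ∀ (V : OpenSet δ) (x : X), x ∈ V.1 → ∃ i, V ∈ F i ∧ x ∈ U i

/-- The master sequence that lists the names of the `U i` at even and those of the `F i` at odd
positions. -/
def master (u β : ℕ → ℕ → ℕ) (n : ℕ) : ℕ :=
  if n % 2 = 1 then β (blockIndex n) (n / 2).unpair.2 else u (blockIndex n) (n / 2).unpair.2

theorem computable_master {u β : ℕ → ℕ → ℕ} (hu : Computable₂ u) (hβ : Computable₂ β) :
    Computable (master u β) := by
  have hi : Computable blockIndex := primrec_blockIndex.to_comp
  have hj : Computable fun n : ℕ => (n / 2).unpair.2 :=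
    (Primrec.snd.comp (Primrec.unpair.comp
      (Primrec.nat_div.comp Primrec.id (Primrec.const 2)))).to_comp
  have hodd : Computable fun n : ℕ => decide (n % 2 = 1) :=
    (PrimrecPred.decide (Primrec.eq.comp (Primrec.nat_mod.comp Primrec.id (Primrec.const 2))
      (Primrec.const 1))).to_comp
  exact (Computable.cond hodd (hβ.comp hi hj) (hu.comp hi hj)).of_eq fun n => by
    simp [master, Bool.cond_decide]

theorem select_master_even (u β : ℕ → ℕ → ℕ) (b : ℕ → Bool) (n : ℕ) :
    select (master u β) b (2 * n) = if b n.unpair.1 = false then u n.unpair.1 n.unpair.2 else 0 := by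
  simp [select, master, blockIndex]

theorem select_master_odd (u β : ℕ → ℕ → ℕ) (b : ℕ → Bool) (n : ℕ) :
    select (master u β) b (2 * n + 1) =
      if b n.unpair.1 = true then β n.unpair.1 n.unpair.2 else 0 := by
  have h1 : (2 * n + 1) % 2 = 1 := by omega
  have h2 : (2 * n + 1) / 2 = n := by omega
  simp [select, master, blockIndex, h1, h2]

theorem exists_gated_iff {u : ℕ → ℕ → ℕ} {P : ℕ → Prop} [DecidablePred P] {a : ℕ} :
    (∃ n : ℕ, (if P n.unpair.1 then u n.unpair.1 n.unpair.2 else 0) = a + 1) ↔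
      ∃ i, P i ∧ ∃ j, u i j = a + 1 := by
  constructor
  · rintro ⟨n, hn⟩
    split_ifs at hn with h
    exact ⟨_, h, _, hn⟩
  · rintro ⟨i, hi, j, hj⟩
    exact ⟨Nat.pair i j, by simp [hi, hj]⟩

/-- Interleaving those names of open sets that satisfy a condition yields a name of their union. -/
theorem openName_gated {X : Type*} {δ : Representation X} {u : ℕ → ℕ → ℕ} {U : ℕ → Set X}
    (hu : ∀ i, OpenName δ (u i) (U i)) (P : ℕ → Prop) [DecidablePred P] :
    OpenName δ (fun n => if P n.unpair.1 then u n.unpair.1 n.unpair.2 else 0)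
      (⋃ (i : ℕ) (_ : P i), U i) := by
  intro q x hq
  rw [exists_comm]
  simp only [exists_gated_iff, Set.mem_iUnion, hu _ q x hq, exists_prop]
  constructor
  · rintro ⟨i, hi, n, k, h⟩
    exact ⟨k, i, hi, n, h⟩
  · rintro ⟨k, i, hi, n, h⟩
    exact ⟨i, hi, n, k, h⟩

namespace ApproxSystem

variable {X : Type*} {δ : Representation X} {u β : ℕ → ℕ → ℕ} (S : ApproxSystem δ u β)
include S

/-- This needs no consistency: every choice describes an open set, and likewise an open family in
`openName_odd`. -/
theorem openName_even (b : ℕ → Bool) :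
    OpenName δ (fun n => select (master u β) b (2 * n)) (⋃ (i : ℕ) (_ : b i = false), S.U i) := by
  simp only [select_master_even]
  exact openName_gated S.name_U _

theorem openName_odd (b : ℕ → Bool) :
    OpenName (openRep δ) (fun n => select (master u β) b (2 * n + 1))
      (⋃ (i : ℕ) (_ : b i = true), S.F i) := by
  simp only [select_master_odd]
  exact openName_gated S.name_F _

/-- The choice `b` is consistent with the closed set `A`. -/
def Consistent (b : ℕ → Bool) (A : ClosedSet δ) : Prop :=
  ∀ i, (b i = false → S.U i ⊆ A.1ᶜ) ∧ (b i = true → (⟨A.1ᶜ, A.2⟩ : OpenSet δ) ∉ S.F i)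

-- A point of the complement of `A` lies in some `U i` whose `F i` contains that complement;
-- consistency then forbids `b i = true`.
omit S in
theorem Consistent.iUnion_eq_compl {S : ApproxSystem δ u β} {b : ℕ → Bool} {A : ClosedSet δ}
    (h : S.Consistent b A) : ⋃ (i : ℕ) (_ : b i = false), S.U i = A.1ᶜ := by
  refine Set.Subset.antisymm (Set.iUnion₂_subset fun i hi => (h i).1 hi) fun x hx => ?_
  obtain ⟨i, hi, hxi⟩ := S.exists_mem ⟨A.1ᶜ, A.2⟩ x hx
  refine Set.mem_iUnion₂.2 ⟨i, ?_, hxi⟩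
  by_contra hb
  exact (h i).2 (by simpa using hb) hi

-- If `V ∈ F i` missed `A`, upward closure would put the complement of `A` into `F i`. Conversely, a
-- point of `A` in `V` lies in some `U i` with `V ∈ F i`, which rules out `b i = false`.
omit S in
theorem Consistent.iUnion_eq_hitting {S : ApproxSystem δ u β} {b : ℕ → Bool} {A : ClosedSet δ}
    (h : S.Consistent b A) : ⋃ (i : ℕ) (_ : b i = true), S.F i = hitting δ A.1 := by
  ext V
  simp only [Set.mem_iUnion, exists_prop]
  constructor
  · rintro ⟨i, hi, hV⟩
    by_contra hA
    refine (h i).2 hi (S.upward i V _ (fun x hx hxA => hA ⟨x, hxA, hx⟩) hV)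
  · rintro ⟨x, hxA, hxV⟩
    obtain ⟨i, hi, hxi⟩ := S.exists_mem V x hxV
    refine ⟨i, ?_, hi⟩
    by_contra hb
    exact (h i).1 (by simpa using hb) hxi hxA

omit S in
theorem Consistent.names {S : ApproxSystem δ u β} {b : ℕ → Bool} {A : ClosedSet δ}
    (h : S.Consistent b A) : (closedOvertRep δ).Names (select (master u β) b) A :=
  ⟨h.iUnion_eq_compl ▸ S.openName_even b, by
    unfold OvertName
    exact h.iUnion_eq_hitting ▸ S.openName_odd b⟩

/-- Set `b i = true` exactly when `U i` meets `A`; members of `F i` contain `U i`, so the complement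
of `A` is then not one of them. -/
theorem exists_consistent (A : ClosedSet δ) : ∃ b, S.Consistent b A := by
  classical
  refine ⟨fun i => !decide (S.U i ⊆ A.1ᶜ), fun i => ⟨fun h => by simpa using h, fun h hF => ?_⟩⟩
  have : ¬ S.U i ⊆ A.1ᶜ := by simpa using h
  exact this (S.subset_of_mem i _ hF)

/-- A choice that is consistent with no closed set is recognized by an overlap of the overt part
with the complement. -/
theorem exists_consistent_of_not_overlap (b : ℕ → Bool)
    (hb : ¬ ∃ n l, select (master u β) b (2 * n + 1) =
      Encodable.encode (pre (fun j => select (master u β) b (2 * j)) l) + 1) :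
    ∃ A, S.Consistent b A := by
  let V : OpenSet δ := ⟨⋃ (i : ℕ) (_ : b i = false), S.U i, _, S.openName_even b⟩
  have hV : (V.1ᶜ)ᶜ = V.1 := compl_compl _
  refine ⟨⟨V.1ᶜ, hV.symm ▸ V.2⟩, fun i => ⟨fun hi => ?_, fun hi hF => hb ?_⟩⟩
  · rw [hV]
    exact Set.subset_iUnion₂ (s := fun i (_ : b i = false) => S.U i) i hi
  -- The even half is itself a name of `V`, so `V` lying in the odd half's family produces an
  -- overlap.
  · refine (S.openName_odd b _ V (S.openName_even b)).1 (Set.mem_iUnion₂.2 ⟨i, hi, ?_⟩)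
    exact S.upward i _ V hV.subset hF

theorem eq_univ_iff_forall_caught {p : ℕ → ℕ} {𝒰 : OpenSet (closedOvertRep δ)}
    (hp : OpenName (closedOvertRep δ) p 𝒰.1) :
    𝒰.1 = Set.univ ↔ ∀ b, Caught p (select (master u β) b) := by
  constructor
  · intro h b
    by_cases hb : ∃ n l, select (master u β) b (2 * n + 1) =
      Encodable.encode (pre (fun j => select (master u β) b (2 * j)) l) + 1
    · obtain ⟨n, l, hnl⟩ := hb
      exact ⟨l, Or.inr ⟨n, hnl⟩⟩
    · obtain ⟨A, hA⟩ := S.exists_consistent_of_not_overlap b hb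
      obtain ⟨n, l, hnl⟩ := (hp _ A hA.names).1 (h ▸ Set.mem_univ A)
      exact ⟨l, Or.inl ⟨n, hnl⟩⟩
  · refine fun h => Set.eq_univ_of_forall fun A => ?_
    obtain ⟨b, hb⟩ := S.exists_consistent A
    obtain ⟨l, ⟨n, hnl⟩ | ⟨n, hnl⟩⟩ := h b
    · exact (hp _ A hb.names).2 ⟨n, l, hnl⟩
    -- An overlap in a genuine name of `A` would make `A` meet its complement.
    · obtain ⟨x, hx, hx'⟩ := (hb.names.2 _ ⟨A.1ᶜ, A.2⟩ hb.names.1).2 ⟨n, l, hnl⟩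
      exact absurd hx hx'

theorem computablyCompact (hu : Computable₂ u) (hβ : Computable₂ β) :
    ComputablyCompact (closedOvertRep δ) :=
  computableMap_sierpinski_of_caught (computable_master hu hβ) fun _ _ hp =>
    S.eq_univ_iff_forall_caught hp

end ApproxSystem

/-! ### From an ercs to an approximation system -/

theorem openName_zero {X : Type*} (δ : Representation X) : OpenName δ (fun _ => 0) ∅ := by
  intro q x _
  simp

/-- Since `R` is only enumerable, an index whose stage has not confirmed its pair gets the empty set
and the empty family. -/
theorem openName_ite {X : Type*} {δ : Representation X} {p : ℕ → ℕ} {V : Set X}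
    (h : OpenName δ p V) (c : Bool) :
    OpenName δ (fun n => if c then p n else 0) {x | c = true ∧ x ∈ V} := by
  cases c
  · simpa using openName_zero δ
  · simpa using h

/-- The `m`, `n` and stage coded by an index. -/
def unpairTriple (i : ℕ) : (ℕ × ℕ) × ℕ := (i.unpair.1.unpair, i.unpair.2)

theorem exists_unpairTriple (m n t : ℕ) : ∃ i, unpairTriple i = ((m, n), t) :=
  ⟨Nat.pair (Nat.pair m n) t, by simp [unpairTriple]⟩

theorem computable_unpairTriple : Computable unpairTriple :=
  ((Primrec.unpair.comp (Primrec.fst.comp Primrec.unpair)).pair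
    (Primrec.snd.comp Primrec.unpair)).to_comp

/-- An effective relatively compact system yields a computable approximation system, indexed by
the pairs `(m, n)` together with a stage of the enumeration of `R`. -/
theorem Ercs.exists_approxSystem {X : Type*} {δ : Representation X} (E : Ercs δ) :
    ∃ u β : ℕ → ℕ → ℕ, Computable₂ u ∧ Computable₂ β ∧ Nonempty (ApproxSystem δ u β) := by
  obtain ⟨u, hu, hU⟩ := E.computable_U
  obtain ⟨β, hβ, hB⟩ := E.computable_B
  obtain ⟨D, hD, hR⟩ := exists_stages E.re_R
  let d : ℕ → Bool := fun i => D (unpairTriple i).1 (unpairTriple i).2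
  have hi : Computable fun x : ℕ × ℕ => unpairTriple x.1 :=
    computable_unpairTriple.comp Computable.fst
  have hd : Computable fun x : ℕ × ℕ => d x.1 :=
    hD.comp (Computable.fst.comp hi) (Computable.snd.comp hi)
  refine ⟨fun i j => if d i then u (unpairTriple i).1.1 j else 0,
    fun i j => if d i then β (unpairTriple i).1.2 j else 0, ?_, ?_, ⟨?_⟩⟩
  · exact (Computable.cond hd (hu.comp (Computable.fst.comp (Computable.fst.comp hi))
      Computable.snd) (Computable.const 0)).of_eq fun x => by simp [cond_eq_ite]
  · exact (Computable.cond hd (hβ.comp (Computable.snd.comp (Computable.fst.comp hi))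
      Computable.snd) (Computable.const 0)).of_eq fun x => by simp [cond_eq_ite]
  · exact
      { U := fun i => {x | d i = true ∧ x ∈ (E.U (unpairTriple i).1.1).1}
        F := fun i => {V | d i = true ∧ V ∈ containing δ (E.B (unpairTriple i).1.2).1}
        name_U := fun i => openName_ite (hU _) (d i)
        name_F := fun i => openName_ite (hB _) (d i)
        subset_of_mem := fun i V hV x hx =>
          hV.2 (E.subset_of_R _ _ ((hR _).2 ⟨_, hV.1⟩) hx.2)
        upward := fun i V W hVW hV => ⟨hV.1, hV.2.trans hVW⟩
        exists_mem := fun V x hx => by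
          have hx' := hx
          rw [E.eq_iUnion V.1 V.2] at hx'
          simp only [Set.mem_iUnion, exists_prop] at hx'
          obtain ⟨n, hn, m, hmn, hxm⟩ := hx'
          obtain ⟨t, ht⟩ := (hR (m, n)).1 hmn
          obtain ⟨i, hi⟩ := exists_unpairTriple m n t
          have hdi : d i = true := by simp only [d, hi, ht]
          exact ⟨i, ⟨hdi, by rw [hi]; exact hn⟩, hdi, by rw [hi]; exact hxm⟩ }

end RepresentedSpace

theorem corollary27 {X : Type u} (δ : RepresentedSpace.Representation X)
    (hX : Nonempty (RepresentedSpace.Ercs δ)) :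
    RepresentedSpace.ComputablyCompact (RepresentedSpace.closedOvertRep δ) := by
  obtain ⟨E⟩ := hX
  obtain ⟨u, β, hu, hβ, ⟨S⟩⟩ := E.exists_approxSystem
  exact S.computablyCompact hu hβ
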